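/- Consider a fully connected synchronous system of $n$ nodes with identifiers $1,\dots,n$ (the congested clique): in each round every node performs arbitrary deterministic local computations, sends to each node (itself included) one message, possibly a different one to each receiver, and receives the messages sent to it. For every constant $c$ there is a constant $C$, depending only on $c$, such that for every $n\ge 1$ and every totally ordered set $\mathcal K$ of keys of size at most $c\,(\lfloor\log_2 n\rfloor+1)$ bits, that is, with $|\mathcal K|\le 2^{c(\lfloor\log_2 n\rfloor+1)}$, there is a deterministic algorithm using messages of $C\,(\lfloor\log_2 n\rfloor+1)$ bits, that is, of size $O(\log n)$, with the following property. Suppose that each node is given $n$ keys from $\mathcal K$ and initially knows only its own keys (besides $n$, its identifier and the ordered set $\mathcal K$). Then, for every such input, after $37$ rounds each node $i\in\{1,\dots,n\}$ knows the keys with indices $(i-1)n+1,\dots,in$, in this order, in the nondecreasing sequence of all $n^2$ input keys, counted with multiplicity. -/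

import Mathlib

namespace CongestedClique

universe u v

/-- The number of bits in the binary representation of `n ≥ 1`; this is `Θ(log n)` for `n ≥ 2`
and equals `1` for `n = 1`. -/
def logSize (n : ℕ) : ℕ := Nat.log 2 n + 1

/-- A message of `B` bits. -/
abbrev Msg (B : ℕ) : Type := Fin B → Bool

/-- A deterministic synchronous algorithm on the fully connected system of `n` nodes with
identifiers `Fin n`, where in every round each node sends one `B`-bit message to every node
(itself included; different receivers may get different messages). Each node starts with an
input in `I` and produces an output in `O`. Local computations are arbitrary functions of the
node's identifier, the round number and the node's own local state. -/
structure Algorithm (n B : ℕ) (I : Type u) (O : Type v) where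
  /-- the local states of a node -/
  State : Type u
  /-- the initial state of a node, as a function of its identifier and its own input -/
  init : Fin n → I → State
  /-- `send t i s j` is the message that node `i` in state `s` sends to node `j` in round `t` -/
  send : ℕ → Fin n → State → Fin n → Msg B
  /-- `receive t i s m` is the new state of node `i` if its state was `s` at the start of
  round `t` and it receives the message `m j` from each node `j` in round `t` -/
  receive : ℕ → Fin n → State → (Fin n → Msg B) → State
  /-- the output that a node reads off its local state -/
  output : Fin n → State → O

namespace Algorithm

variable {n B : ℕ} {I : Type u} {O : Type v}

/-- The states of all nodes after `t` rounds on the input `x`. -/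
def run (A : Algorithm n B I O) (x : Fin n → I) : ℕ → Fin n → A.State
  | 0 => fun i => A.init i (x i)
  | t + 1 => fun i =>
      A.receive t i (A.run x t i) (fun j => A.send t j (A.run x t j) i)

/-- The outputs of all nodes after `T` rounds on the input `x`. -/
def outputAfter (A : Algorithm n B I O) (T : ℕ) (x : Fin n → I) (i : Fin n) : O :=
  A.output i (A.run x T i)

end Algorithm

variable {n B : ℕ} {K : Type u} [LinearOrder K]

/-- All keys in the system in nondecreasing order, with multiplicity; `x i j` is the `j`-th key
given to node `i`. -/
def sortedKeys (x : Fin n → Fin n → K) : List K :=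
  ((Finset.univ : Finset (Fin n × Fin n)).val.map fun p => x p.1 p.2).sort (· ≤ ·)

/-- `y` solves the sorting problem on the input `x`: node `i` (counting from `0`) knows the keys
at the positions `i * n, …, i * n + n - 1` (counting from `0`) of the sorted sequence of all keys,
where `y i r` is the key at position `i * n + r`. -/
def IsSortingOutput (x y : Fin n → Fin n → K) : Prop :=
  ∀ i r : Fin n, (sortedKeys x)[(i : ℕ) * n + (r : ℕ)]? = some (y i r)

/-- The algorithm `A` sorts in `T` rounds, whatever the `n` keys given to each node are. -/
def SortsIn (A : Algorithm n B (Fin n → K) (Fin n → K)) (T : ℕ) : Prop :=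
  ∀ x : Fin n → Fin n → K, IsSortingOutput x (A.outputAfter T x)

end CongestedClique

/-! Regard the `n²` keys as one array. A fixed, input-independent sequence of 16 partitions into
blocks of at most `8 * n` positions sorts it when each block is sorted in place (`sortNet_sq`). Such
a network is analysed one threshold at a time (the 0-1 principle, `filter_sortArrays_le`): only the
set of positions holding small keys matters, and it must end up an initial segment. Columnsort
(`isLowerSet_columnsort`) sorts about `R^(3/2)` elements by four passes over blocks of size about
`R`, so one level takes blocks of size `O(n)` to `n^(3/2)` elements. A second level, with each of
its four passes simulated by the first network (`SortNet.simulate`), reaches `n²`.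

Since the partitions do not depend on the input, all data movement is fixed in advance and messages
carry no addresses. Blocks are given whole to nodes, at most `9 * n` keys each (`exists_owner`). An
edge colouring with `18 * n` colours then routes any such redistribution in two rounds via relays,
with 18 keys per message (`Holds.route`). Sixteen block sorts and a final delivery take `2 * 16 + 2
= 34` rounds; the remaining three are padding. -/

namespace CongestedClique

universe u

open Finset

/-! ### Block sorting at a single threshold -/

section SortSet

variable {L : ℕ}

/-- The number of elements before `p` in its block. -/
def blockRank (b : Fin L → ℕ) (p : Fin L) : ℕ := #{q | b q = b p ∧ q < p}

/-- The effect of sorting every block of `b` in place, seen at one threshold: `Z` is the set of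
positions holding a small key, and within each block the small keys move to the front. -/
def sortSet (b : Fin L → ℕ) (Z : Finset (Fin L)) : Finset (Fin L) :=
  {p | blockRank b p < #{q | b q = b p ∧ q ∈ Z}}

/-- The successive effect of a list of block sorts at one threshold. -/
def sortSets (bs : List (Fin L → ℕ)) (Z : Finset (Fin L)) : Finset (Fin L) :=
  bs.foldl (fun Z b => sortSet b Z) Z

theorem mem_sortSet {b : Fin L → ℕ} {Z : Finset (Fin L)} {p : Fin L} :
    p ∈ sortSet b Z ↔ blockRank b p < #{q | b q = b p ∧ q ∈ Z} := by
  simp [sortSet]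

theorem blockRank_lt {b : Fin L → ℕ} {p q : Fin L} (h : b q = b p) (hqp : q < p) :
    blockRank b q < blockRank b p := by
  unfold blockRank
  apply card_lt_card
  refine ⟨fun r hr => ?_, fun hsub => ?_⟩
  · simp only [mem_filter, mem_univ, true_and] at hr ⊢
    exact ⟨hr.1.trans h, hr.2.trans hqp⟩
  · have := @hsub q (by simp [h, hqp])
    simp at this

theorem blockRank_injOn {b : Fin L → ℕ} {p q : Fin L} (h : b q = b p)
    (hr : blockRank b q = blockRank b p) : q = p := by
  rcases lt_trichotomy q p with hlt | heq | hlt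
  · exact absurd hr (blockRank_lt h hlt).ne
  · exact heq
  · exact absurd hr (blockRank_lt h.symm hlt).ne'

theorem blockRank_lt_iff {b : Fin L → ℕ} {p q : Fin L} (h : b q = b p) :
    blockRank b q < blockRank b p ↔ q < p := by
  refine ⟨fun hlt => ?_, blockRank_lt h⟩
  by_contra hle
  rcases (not_lt.mp hle).eq_or_lt with heq | hlt'
  · subst heq; exact lt_irrefl _ hlt
  · exact absurd (blockRank_lt h.symm hlt') (by omega)

theorem blockRank_lt_card (b : Fin L → ℕ) (p : Fin L) :
    blockRank b p < #{q | b q = b p} := by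
  apply card_lt_card
  refine ⟨fun r hr => ?_, fun hsub => ?_⟩
  · simp only [mem_filter, mem_univ, true_and] at hr ⊢
    exact hr.1
  · have := @hsub p (by simp)
    simp at this

/-- The ranks in a block form an initial segment of `ℕ`. -/
theorem exists_blockRank_eq {b : Fin L → ℕ} {c m : ℕ} (hm : m < #{q | b q = c}) :
    ∃ p, b p = c ∧ blockRank b p = m := by
  have himg : image (blockRank b) {q | b q = c} = range #{q | b q = c} := by
    apply eq_of_subset_of_card_le
    · intro r hr
      simp only [mem_image, mem_filter, mem_univ, true_and] at hr
      obtain ⟨q, hq, rfl⟩ := hr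
      have := blockRank_lt_card b q
      rw [hq] at this
      exact mem_range.mpr this
    · rw [card_range, card_image_of_injOn]
      intro p hp q hq hpq
      simp only [coe_filter, mem_univ, true_and, Set.mem_ofPred_eq] at hp hq
      exact blockRank_injOn (hp.trans hq.symm) hpq
  have : m ∈ image (blockRank b) {q | b q = c} := by rw [himg]; exact mem_range.mpr hm
  simpa using this

theorem card_block_rank_lt {b : Fin L → ℕ} {c m : ℕ} (hm : m ≤ #{q | b q = c}) :
    #{q | b q = c ∧ blockRank b q < m} = m := by
  have : image (blockRank b) {q | b q = c ∧ blockRank b q < m} = range m := by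
    ext r
    simp only [mem_image, mem_filter, mem_univ, true_and, mem_range]
    constructor
    · rintro ⟨q, ⟨-, hq⟩, rfl⟩; exact hq
    · intro hr
      obtain ⟨p, hp, hpr⟩ := exists_blockRank_eq (lt_of_lt_of_le hr hm)
      exact ⟨p, ⟨hp, hpr ▸ hr⟩, hpr⟩
  conv_rhs => rw [← card_range m, ← this]
  rw [card_image_of_injOn]
  intro p hp q hq hpq
  simp only [coe_filter, mem_univ, true_and, Set.mem_ofPred_eq] at hp hq
  exact blockRank_injOn (hp.1.trans hq.1.symm) hpq

/-- The number of small keys in a block never exceeds the block size, so the initial segment of that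
length fits into the block. -/
theorem card_block_sortSet (b : Fin L → ℕ) (Z : Finset (Fin L)) (c : ℕ) :
    #{q | b q = c ∧ q ∈ sortSet b Z} = #{q | b q = c ∧ q ∈ Z} := by
  have hle : #{q | b q = c ∧ q ∈ Z} ≤ #{q | b q = c} :=
    card_le_card fun q hq => by
      simp only [mem_filter, mem_univ, true_and] at hq ⊢; exact hq.1
  rw [← card_block_rank_lt hle]
  congr 1
  ext q
  simp only [mem_filter, mem_univ, true_and, mem_sortSet]
  constructor
  · rintro ⟨rfl, h⟩; exact ⟨rfl, h⟩
  · rintro ⟨rfl, h⟩; exact ⟨rfl, h⟩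

theorem card_sortSet (b : Fin L → ℕ) (Z : Finset (Fin L)) : #(sortSet b Z) = #Z := by
  have key : ∀ W : Finset (Fin L),
      #W = ∑ c ∈ univ.image b, #{q | b q = c ∧ q ∈ W} := by
    intro W
    rw [card_eq_sum_card_fiberwise (f := b) (t := univ.image b)
      (fun x _ => by simp)]
    refine sum_congr rfl fun c _ => ?_
    congr 1
    ext q
    simp [and_comm]
  rw [key, key Z]
  exact sum_congr rfl fun c _ => card_block_sortSet b Z c

theorem card_sortSets (bs : List (Fin L → ℕ)) (Z : Finset (Fin L)) :
    #(sortSets bs Z) = #Z := by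
  induction bs generalizing Z with
  | nil => rfl
  | cons b bs ih => exact (ih (sortSet b Z)).trans (card_sortSet b Z)

theorem sortSets_append (bs cs : List (Fin L → ℕ)) (Z : Finset (Fin L)) :
    sortSets (bs ++ cs) Z = sortSets cs (sortSets bs Z) := List.foldl_append

/-- Within a block, `sortSet` is an initial segment. -/
theorem sortSet_mem_of_lt {b : Fin L → ℕ} {Z : Finset (Fin L)} {p q : Fin L}
    (hp : p ∈ sortSet b Z) (h : b q = b p) (hqp : q < p) : q ∈ sortSet b Z := by
  rw [mem_sortSet] at hp ⊢
  rw [h]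
  exact (blockRank_lt h hqp).trans hp

/-- With its companion below, this shows that no block sort spoils an all-small prefix or an
all-large suffix of the array. -/
theorem mem_sortSet_of_forall_le {b : Fin L → ℕ} {Z : Finset (Fin L)} {p : Fin L}
    (h : ∀ q ≤ p, q ∈ Z) : p ∈ sortSet b Z := by
  rw [mem_sortSet]
  apply card_lt_card
  refine ⟨fun r hr => ?_, fun hsub => ?_⟩
  · simp only [mem_filter, mem_univ, true_and] at hr ⊢
    exact ⟨hr.1, h r hr.2.le⟩
  · have := @hsub p (by simp [h p le_rfl])
    simp at this

theorem notMem_sortSet_of_forall_ge {b : Fin L → ℕ} {Z : Finset (Fin L)} {p : Fin L}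
    (h : ∀ q, p ≤ q → q ∉ Z) : p ∉ sortSet b Z := by
  rw [mem_sortSet, not_lt]
  refine card_le_card fun r hr => ?_
  simp only [mem_filter, mem_univ, true_and] at hr ⊢
  refine ⟨hr.1, ?_⟩
  by_contra hle
  exact h r (not_lt.mp hle) hr.2

theorem sortSet_eq_self_of_isLowerSet {b : Fin L → ℕ} {Z : Finset (Fin L)}
    (h : IsLowerSet (Z : Set (Fin L))) : sortSet b Z = Z := by
  ext p
  constructor
  · intro hp
    by_contra hpZ
    exact notMem_sortSet_of_forall_ge (fun q hpq hq => hpZ (h hpq hq)) hp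
  · intro hp
    exact mem_sortSet_of_forall_le fun q hq => h hq hp

/-- A lower set is determined by its cardinality. Block sorts preserve cardinality, so the result of
a sorting network depends only on the number of small keys. -/
theorem mem_iff_lt_card_of_isLowerSet {Z : Finset (Fin L)} (h : IsLowerSet (Z : Set (Fin L)))
    (p : Fin L) : p ∈ Z ↔ (p : ℕ) < #Z := by
  constructor
  · intro hp
    have : Iic p ⊆ Z := fun q hq => h (mem_Iic.mp hq) hp
    have := card_le_card this
    rw [Fin.card_Iic] at this
    omega
  · intro hp
    by_contra hpZ
    have : Z ⊆ Iio p := fun q hq => by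
      rw [mem_Iio]
      by_contra hle
      exact hpZ (h (not_lt.mp hle) hq)
    have := card_le_card this
    rw [Fin.card_Iio] at this
    omega

end SortSet

/-! ### Columnsort -/

section Columnsort

variable {L : ℕ}

/-- If the small keys are in order except inside a window of length `w`, sorting aligned blocks of
length `2 * w` and then blocks shifted by `w` puts them in order. -/
theorem isLowerSet_sort_windows {w lo : ℕ} (hw : 0 < w) {Z : Finset (Fin L)}
    (hlo : ∀ p : Fin L, (p : ℕ) < lo → p ∈ Z) (hhi : ∀ p ∈ Z, (p : ℕ) < lo + w) :
    IsLowerSet (sortSet (fun p => ((p : ℕ) + w) / (2 * w))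
      (sortSet (fun p => (p : ℕ) / (2 * w)) Z) : Set (Fin L)) := by
  have keepLo : ∀ (b : Fin L → ℕ) (W : Finset (Fin L)), (∀ p : Fin L, (p : ℕ) < lo → p ∈ W) →
      ∀ p : Fin L, (p : ℕ) < lo → p ∈ sortSet b W := fun b W hW p hp =>
    mem_sortSet_of_forall_le fun q hq => hW q (lt_of_le_of_lt hq hp)
  have keepHi : ∀ (b : Fin L → ℕ) (W : Finset (Fin L)), (∀ p ∈ W, (p : ℕ) < lo + w) →
      ∀ p ∈ sortSet b W, (p : ℕ) < lo + w := fun b W hW p hp => by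
    by_contra hle
    refine notMem_sortSet_of_forall_ge (fun q hpq hq => ?_) hp
    have := hW q hq
    have : (p : ℕ) ≤ q := hpq
    omega
  set Y := sortSet (fun p : Fin L => (p : ℕ) / (2 * w)) Z with hY
  have hYlo := keepLo (fun p => (p : ℕ) / (2 * w)) Z hlo
  have hYhi := keepHi (fun p => (p : ℕ) / (2 * w)) Z hhi
  rw [← hY] at hYlo hYhi
  set X := sortSet (fun p : Fin L => ((p : ℕ) + w) / (2 * w)) Y with hX
  have hXlo := keepLo (fun p => ((p : ℕ) + w) / (2 * w)) Y hYlo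
  have hXhi := keepHi (fun p => ((p : ℕ) + w) / (2 * w)) Y hYhi
  rw [← hX] at hXlo hXhi
  intro p q hqp hp
  simp only [mem_coe] at hp ⊢
  rcases hqp.eq_or_lt with heq | hlt
  · rw [heq]; exact hp
  by_cases hsame : ((q : ℕ) + w) / (2 * w) = ((p : ℕ) + w) / (2 * w)
  · exact sortSet_mem_of_lt hp hsame hlt
  by_contra hq
  have hqlo : lo ≤ (q : ℕ) := by
    by_contra h
    exact hq (hXlo q (by omega))
  have hphi := hXhi p hp
  have hlt' : (q : ℕ) < p := hlt
  have hdiv : ((q : ℕ) + w) / (2 * w) < ((p : ℕ) + w) / (2 * w) :=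
    lt_of_le_of_ne (Nat.div_le_div_right (by omega)) hsame
  -- The shifted-block boundary `c * (2 * w) + w` separates `q` from `p`, both in the window. Having
  -- length only `w`, the window lies inside the aligned block `c`, so the first sort already
  -- ordered it and the second changes nothing.
  obtain ⟨c, hc⟩ : ∃ c, ((p : ℕ) + w) / (2 * w) = c + 1 :=
    ⟨_, (Nat.succ_pred_eq_of_pos (Nat.zero_lt_of_lt hdiv)).symm⟩
  have h1 : (c + 1) * (2 * w) ≤ (p : ℕ) + w :=
    (Nat.le_div_iff_mul_le (by omega)).mp hc.ge
  have h2 : (q : ℕ) + w < (c + 1) * (2 * w) :=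
    (Nat.div_lt_iff_lt_mul (by omega)).mp (hc ▸ hdiv)
  have h3 : (c + 1) * (2 * w) = c * (2 * w) + 2 * w := by ring
  have hblock : ∀ r : ℕ, lo ≤ r → r < lo + w → r / (2 * w) = c := by
    intro r hr1 hr2
    apply Nat.div_eq_of_lt_le
    · omega
    · rw [h3]; omega
  have hYlower : IsLowerSet (Y : Set (Fin L)) := by
    intro s r hrs hs
    simp only [mem_coe] at hs ⊢
    rcases hrs.eq_or_lt with heq | hlt
    · rw [heq]; exact hs
    by_cases hr : (r : ℕ) < lo
    · exact hYlo r hr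
    · have hs' := hYhi s hs
      have hrs' : (r : ℕ) < s := hlt
      exact sortSet_mem_of_lt hs
        ((hblock r (by omega) (by omega)).trans (hblock s (by omega) (by omega)).symm) hlt
  have hXY : X = Y := sortSet_eq_self_of_isLowerSet hYlower
  rw [hXY] at hp hq
  exact hq (hYlower hlt.le hp)

/-- The rank within a column is the row number: the earlier positions of the column are `i * S + p %
S` with `i < p / S`. -/
theorem blockRank_mod {S : ℕ} (hS : 0 < S) (p : Fin L) :
    blockRank (fun q : Fin L => (q : ℕ) % S) p = (p : ℕ) / S := by
  rw [← card_range ((p : ℕ) / S)]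
  unfold blockRank
  refine card_bij' (fun q _ => (q : ℕ) / S)
    (fun i hi => ⟨i * S + (p : ℕ) % S, ?_⟩) ?_ ?_ ?_ ?_
  · have h1 := mem_range.mp hi
    have h2 := Nat.div_add_mod (p : ℕ) S
    have h3 : S * (i + 1) ≤ S * ((p : ℕ) / S) := Nat.mul_le_mul_left _ h1
    have h4 := Nat.mod_lt (p : ℕ) hS
    have h5 : S * (i + 1) = i * S + S := by ring
    have := p.2
    omega
  · intro q hq
    simp only [mem_filter, mem_univ, true_and] at hq
    obtain ⟨hq1, hq2⟩ := hq
    have hq2' : (q : ℕ) < p := hq2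
    rw [mem_range]
    by_contra hle
    have h1 := Nat.div_add_mod (p : ℕ) S
    have h2 := Nat.div_add_mod (q : ℕ) S
    have := Nat.mul_le_mul_left S (not_lt.mp hle)
    omega
  · intro i hi
    have h1 := mem_range.mp hi
    have h2 := Nat.div_add_mod (p : ℕ) S
    have h3 : S * (i + 1) ≤ S * ((p : ℕ) / S) := Nat.mul_le_mul_left _ h1
    have h5 : S * (i + 1) = i * S + S := by ring
    simp only [mem_filter, mem_univ, true_and, Fin.lt_def]
    refine ⟨by simp, ?_⟩
    omega
  · intro q hq
    simp only [mem_filter, mem_univ, true_and] at hq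
    ext
    simp only
    rw [← hq.1]
    exact Nat.div_add_mod' _ _
  · intro i hi
    simp only
    rw [mul_comm, Nat.mul_add_div hS, Nat.div_eq_of_lt (Nat.mod_lt _ hS), add_zero]

/-- After sorting bands of `h` rows, any two of the `S` columns have almost equally many small
keys. -/
theorem card_column_le {S h k : ℕ} (hS : 0 < S) (hL : L = S * h * k)
    (Z : Finset (Fin L)) (t t' : ℕ) (ht' : t' < S) :
    #{p : Fin L | (p : ℕ) % S = t ∧ p ∈ sortSet (fun p => (p : ℕ) / (S * h)) Z} ≤
      #{p : Fin L | (p : ℕ) % S = t' ∧ p ∈ sortSet (fun p => (p : ℕ) / (S * h)) Z} + k := by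
  set Y := sortSet (fun p : Fin L => (p : ℕ) / (S * h)) Z with hY
  -- The top row of each band is split off, as it has no row above it in its band; it costs one
  -- element per band, `k` in all.
  have hsplit : ({p : Fin L | (p : ℕ) % S = t ∧ p ∈ Y} : Finset (Fin L)) ⊆
      ({p : Fin L | ((p : ℕ) % S = t ∧ p ∈ Y) ∧ (p : ℕ) / S % h ≠ 0} : Finset (Fin L)) ∪
      ({p : Fin L | (p : ℕ) % S = t ∧ (p : ℕ) / S % h = 0} : Finset (Fin L)) := by
    intro p hp
    simp only [mem_filter, mem_univ, true_and, mem_union] at hp ⊢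
    by_cases h0 : (p : ℕ) / S % h = 0
    · exact Or.inr ⟨hp.1, h0⟩
    · exact Or.inl ⟨hp, h0⟩
  refine (card_le_card hsplit).trans ((card_union_le _ _).trans (Nat.add_le_add ?_ ?_))
  · have hrow : ∀ p : Fin L, (p : ℕ) / S % h ≠ 0 →
        S * ((p : ℕ) / S - 1) + S = S * ((p : ℕ) / S) ∧ S * ((p : ℕ) / S) ≤ p := by
      intro p hp
      have h1 : (p : ℕ) / S ≠ 0 := fun h0 => hp (by simp [h0])
      obtain ⟨r, hr⟩ := Nat.exists_eq_succ_of_ne_zero h1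
      refine ⟨?_, Nat.mul_div_le _ _⟩
      rw [hr]; simp [Nat.mul_succ]
    -- Each remaining position moves up one row, to column `t'`. This is an earlier position of the
    -- same sorted band, hence also small. The `else` branch never occurs here.
    refine card_le_card_of_injOn
      (fun p => if hp : S * ((p : ℕ) / S - 1) + t' < L then ⟨S * ((p : ℕ) / S - 1) + t', hp⟩ else p)
      ?_ ?_
    · intro p hp
      simp only [coe_filter, mem_univ, true_and, Set.mem_ofPred_eq] at hp ⊢
      obtain ⟨⟨-, hpY⟩, hp0⟩ := hp
      obtain ⟨h1, h2⟩ := hrow p hp0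
      have hlt : S * ((p : ℕ) / S - 1) + t' < L := by have := p.2; omega
      rw [dif_pos hlt]
      refine ⟨by simp [Nat.mod_eq_of_lt ht'], ?_⟩
      refine sortSet_mem_of_lt hpY ?_ (by simp only [Fin.lt_def]; omega)
      simp only
      rw [← Nat.div_div_eq_div_mul, ← Nat.div_div_eq_div_mul, Nat.mul_add_div hS,
        Nat.div_eq_of_lt ht', add_zero]
      generalize (p : ℕ) / S = r at hp0
      obtain ⟨r, rfl⟩ : ∃ s, r = s + 1 := ⟨r - 1, by
        have : r ≠ 0 := fun h0 => hp0 (by simp [h0])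
        omega⟩
      rw [Nat.add_sub_cancel, Nat.succ_div_of_not_dvd]
      exact fun hd => hp0 (Nat.mod_eq_zero_of_dvd hd)
    · intro p hp q hq hpq
      simp only [coe_filter, mem_univ, true_and, Set.mem_ofPred_eq] at hp hq
      obtain ⟨h1, h2⟩ := hrow p hp.2
      obtain ⟨h1', h2'⟩ := hrow q hq.2
      have hlt : S * ((p : ℕ) / S - 1) + t' < L := by have := p.2; omega
      have hlt' : S * ((q : ℕ) / S - 1) + t' < L := by have := q.2; omega
      simp only [dif_pos hlt, dif_pos hlt', Fin.mk.injEq] at hpq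
      have e1 := Nat.div_add_mod (p : ℕ) S
      have e2 := Nat.div_add_mod (q : ℕ) S
      rw [hp.1.1] at e1
      rw [hq.1.1] at e2
      ext
      omega
  · rw [← card_range k]
    refine card_le_card_of_injOn (fun p => (p : ℕ) / S / h) ?_ ?_
    · intro p _
      simp only [coe_range, Set.mem_Iio]
      rw [Nat.div_div_eq_div_mul]
      exact Nat.div_lt_of_lt_mul (hL ▸ p.2)
    · intro p hp q hq hpq
      simp only [coe_filter, mem_univ, true_and, Set.mem_ofPred_eq] at hp hq hpq
      have e1 := Nat.div_add_mod (p : ℕ) S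
      have e2 := Nat.div_add_mod (q : ℕ) S
      have e3 := Nat.div_add_mod ((p : ℕ) / S) h
      have e4 := Nat.div_add_mod ((q : ℕ) / S) h
      rw [hp.2, hpq, add_zero] at e3
      rw [hq.2, add_zero] at e4
      ext
      rw [← e1, ← e2, hp.1, hq.1, ← e3, e4]

/-- Leighton's Columnsort on `h * k` rows and `S` columns, performed in place along the row-major
order: sort bands of `h` rows, then columns, then bands of `2 * k` rows, then the bands of `2 * k`
rows shifted by `k` rows. -/
theorem isLowerSet_columnsort {S h k : ℕ} (hS : 0 < S) (hk : 0 < k) (hL : L = S * h * k)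
    (Z : Finset (Fin L)) :
    IsLowerSet (sortSets [fun p => (p : ℕ) / (S * h), fun p => (p : ℕ) % S,
      fun p => (p : ℕ) / (2 * (k * S)), fun p => ((p : ℕ) + k * S) / (2 * (k * S))] Z :
        Set (Fin L)) := by
  simp only [sortSets, List.foldl_cons, List.foldl_nil]
  set Y := sortSet (fun p : Fin L => (p : ℕ) / (S * h)) Z with hY
  set C : ℕ → ℕ := fun t => #{p : Fin L | (p : ℕ) % S = t ∧ p ∈ Y} with hC
  obtain ⟨t₀, ht₀, hmin⟩ := exists_min_image (range S) C ⟨0, mem_range.mpr hS⟩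
  have hmem : ∀ p : Fin L, p ∈ sortSet (fun p : Fin L => (p : ℕ) % S) Y ↔
      (p : ℕ) / S < C ((p : ℕ) % S) := by
    intro p
    rw [mem_sortSet, blockRank_mod hS]
  -- With `t₀` a column having fewest small keys, the sorted columns are all small in the first `C
  -- t₀` rows and all large from row `C t₀ + k` on.
  refine isLowerSet_sort_windows (lo := C t₀ * S) (Nat.mul_pos hk hS) ?_ ?_
  · intro p hp
    rw [hmem]
    exact ((Nat.div_lt_iff_lt_mul hS).mpr hp).trans_le
      (hmin _ (mem_range.mpr (Nat.mod_lt _ hS)))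
  · intro p hp
    rw [hmem] at hp
    have := card_column_le hS hL Z ((p : ℕ) % S) t₀ (mem_range.mp ht₀)
    rw [← add_mul, ← Nat.div_lt_iff_lt_mul hS]
    exact hp.trans_le this

end Columnsort

/-! ### Composition of sorting networks -/

section SortNet

variable {L : ℕ}

/-- There is a list of `k` block sorts on `Fin L`, with blocks of at most `M` elements, that
sorts everything. -/
def SortNet (M k L : ℕ) : Prop :=
  ∃ bs : List (Fin L → ℕ), bs.length = k ∧ (∀ b ∈ bs, ∀ c, #{p | b p = c} ≤ M) ∧
    ∀ Z : Finset (Fin L), IsLowerSet (sortSets bs Z : Set (Fin L))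

theorem isLowerSet_sortSet_const (Z : Finset (Fin L)) :
    IsLowerSet (sortSet (fun _ => 0) Z : Set (Fin L)) := by
  intro p q hqp hp
  rcases hqp.eq_or_lt with heq | hlt
  · rw [heq]; exact hp
  · exact sortSet_mem_of_lt hp rfl hlt

theorem sortNet_one (M : ℕ) : SortNet M 1 M := by
  refine ⟨[fun _ => 0], rfl, fun b _ c => ?_, isLowerSet_sortSet_const⟩
  exact (card_le_univ _).trans (by simp)

/-- The ranks, within the block `c` of `f`, of the elements of `Z`. -/
def blockTrace {R : ℕ} (f : Fin L → ℕ) (c : ℕ) (Z : Finset (Fin L)) : Finset (Fin R) :=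
  {i | ∃ p ∈ Z, f p = c ∧ blockRank f p = i}

theorem mem_blockTrace {R : ℕ} {f : Fin L → ℕ} {Z : Finset (Fin L)} {p : Fin L} {i : Fin R}
    (hi : blockRank f p = i) : i ∈ blockTrace f (f p) Z ↔ p ∈ Z := by
  simp only [blockTrace, mem_filter, mem_univ, true_and]
  constructor
  · rintro ⟨q, hq, hqp, hqi⟩
    rwa [← blockRank_injOn hqp (hqi.trans hi.symm)]
  · exact fun hp => ⟨p, hp, rfl, hi⟩

theorem card_blockTrace_filter {R : ℕ} {f : Fin L → ℕ} (b : Fin R → ℕ)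
    (c d : ℕ) (Z : Finset (Fin L)) (g : Fin L → Fin R)
    (hg : ∀ p, blockRank f p = g p) :
    #{j | b j = d ∧ j ∈ blockTrace f c Z} = #{q | (f q = c ∧ b (g q) = d) ∧ q ∈ Z} := by
  symm
  refine card_bij (fun q _ => g q) ?_ ?_ ?_
  · intro q hq
    simp only [mem_filter, mem_univ, true_and] at hq ⊢
    obtain ⟨⟨rfl, hd⟩, hZ⟩ := hq
    exact ⟨hd, (mem_blockTrace (hg q)).mpr hZ⟩
  · intro p hp q hq hpq
    simp only [mem_filter, mem_univ, true_and] at hp hq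
    exact blockRank_injOn (hp.1.1.trans hq.1.1.symm) (by rw [hg, hg, hpq])
  · intro j hj
    simp only [blockTrace, mem_filter, mem_univ, true_and] at hj
    obtain ⟨hd, q, hqZ, hqc, hqj⟩ := hj
    have : g q = j := by ext; rw [← hg, hqj]
    exact ⟨q, by simp [hqc, this, hd, hqZ], this⟩

/-- Sorting blocks inside the blocks of `f` acts on each block of `f` separately. -/
theorem blockTrace_sortSet {R : ℕ} {f : Fin L → ℕ} (b : Fin R → ℕ)
    (c : ℕ) (Z : Finset (Fin L)) (g : Fin L → Fin R)
    (hg : ∀ p, blockRank f p = g p) :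
    blockTrace f c (sortSet (fun p => Nat.pair (f p) (b (g p))) Z) =
      sortSet b (blockTrace f c Z) := by
  ext j
  by_cases hj : (j : ℕ) < #{q | f q = c}
  · obtain ⟨p, rfl, hpj⟩ := exists_blockRank_eq hj
    have hgp : g p = j := by ext; rw [← hg, hpj]
    rw [mem_blockTrace hpj, mem_sortSet, mem_sortSet, card_blockTrace_filter b _ _ Z g hg]
    have h1 : blockRank (fun p => Nat.pair (f p) (b (g p))) p = blockRank b j := by
      unfold blockRank
      refine card_bij (fun q _ => g q) ?_ ?_ ?_
      · intro q hq
        simp only [mem_filter, mem_univ, true_and, Nat.pair_eq_pair] at hq ⊢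
        refine ⟨hq.1.2.trans (by rw [hgp]), ?_⟩
        rw [Fin.lt_def, ← hg, ← hpj]
        exact blockRank_lt hq.1.1 hq.2
      · intro q hq r hr hqr
        simp only [mem_filter, mem_univ, true_and, Nat.pair_eq_pair] at hq hr
        exact blockRank_injOn (hq.1.1.trans hr.1.1.symm) (by rw [hg, hg, hqr])
      · intro i hi
        simp only [mem_filter, mem_univ, true_and, Fin.lt_def] at hi
        obtain ⟨q, hq, hqi⟩ := exists_blockRank_eq (hi.2.trans hj)
        have hgq : g q = i := by ext; rw [← hg, hqi]
        refine ⟨q, ?_, hgq⟩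
        simp only [mem_filter, mem_univ, true_and, Nat.pair_eq_pair]
        refine ⟨⟨hq, by rw [hgq, hgp, hi.1]⟩, ?_⟩
        rw [← blockRank_lt_iff hq, hqi, hpj]
        exact hi.2
    rw [h1, hgp]
    simp only [Nat.pair_eq_pair]
  -- The block `c` may have fewer than `R` elements; an index `j` beyond its size lies in neither
  -- trace.
  · have hlt : ∀ W : Finset (Fin L), ∀ i ∈ blockTrace (R := R) f c W, i < j := by
      intro W i hi
      simp only [blockTrace, mem_filter, mem_univ, true_and] at hi
      obtain ⟨q, -, hq, hqi⟩ := hi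
      have := blockRank_lt_card f q
      rw [hq, hqi] at this
      rw [Fin.lt_def]
      omega
    refine iff_of_false (fun h => lt_irrefl _ (hlt _ _ h)) ?_
    exact notMem_sortSet_of_forall_ge fun q hq hqZ => absurd (hlt _ _ hqZ) (not_lt.mpr hq)

/-- A sorting network for `R` elements, run inside every block of `f`, sorts these blocks. -/
theorem SortNet.simulate {M k R : ℕ} (hN : SortNet M k R) {f : Fin L → ℕ}
    (hf : ∀ c, #{p | f p = c} ≤ R) :
    ∃ bs : List (Fin L → ℕ), bs.length = k ∧ (∀ b ∈ bs, ∀ c, #{p | b p = c} ≤ M) ∧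
      ∀ Z : Finset (Fin L), sortSets bs Z = sortSet f Z := by
  obtain ⟨bs, hlen, hM, hsort⟩ := hN
  let g : Fin L → Fin R := fun p => ⟨blockRank f p, (blockRank_lt_card f p).trans_le (hf _)⟩
  have hg : ∀ p, blockRank f p = g p := fun p => rfl
  -- Pairing with `f p` keeps the copies of the network in different blocks of `f` apart.
  refine ⟨bs.map fun b p => Nat.pair (f p) (b (g p)), by simpa using hlen, ?_, ?_⟩
  · intro b' hb' c
    obtain ⟨b, hb, rfl⟩ := List.mem_map.mp hb'
    refine le_trans ?_ (hM b hb c.unpair.2)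
    refine card_le_card_of_injOn g ?_ ?_
    · intro p hp
      simp only [coe_filter, mem_univ, true_and, Set.mem_ofPred_eq] at hp ⊢
      rw [← hp, Nat.unpair_pair]
    · intro p hp q hq hpq
      simp only [coe_filter, mem_univ, true_and, Set.mem_ofPred_eq] at hp hq
      exact blockRank_injOn (Nat.pair_eq_pair.mp (hp.trans hq.symm)).1 (by rw [hg, hg, hpq])
  · intro Z
    have htrace : ∀ (cs : List (Fin R → ℕ)) (c : ℕ) (Z : Finset (Fin L)),
        blockTrace f c (sortSets (cs.map fun b p => Nat.pair (f p) (b (g p))) Z) =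
          sortSets cs (blockTrace f c Z) := by
      intro cs c
      induction cs with
      | nil => exact fun _ => rfl
      | cons b cs ih =>
        intro Z
        change blockTrace f c (sortSets _ (sortSet _ Z)) = sortSets cs (sortSet b _)
        rw [ih, blockTrace_sortSet b c Z g hg]
    -- The network leaves in each block an initial segment with the original number of small keys,
    -- which is what `sortSet f` leaves.
    ext p
    rw [← mem_blockTrace (hg p), htrace, mem_iff_lt_card_of_isLowerSet (hsort _), card_sortSets,
      mem_sortSet, ← hg]
    have := card_blockTrace_filter (fun _ => 0) (f p) 0 Z g hg
    simp only [true_and, and_true, filter_mem_eq_inter, univ_inter] at this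
    rw [this]

/-- The whole smaller array is one block of at most `L` elements, in which the larger network is
simulated. -/
theorem SortNet.mono {M k L L' : ℕ} (hN : SortNet M k L) (h : L' ≤ L) : SortNet M k L' := by
  obtain ⟨bs, hlen, hM, hsort⟩ := hN.simulate (L := L') (f := fun _ => 0)
    fun c => (card_le_univ _).trans (by simpa using h)
  exact ⟨bs, hlen, hM, fun Z => hsort Z ▸ isLowerSet_sortSet_const Z⟩

theorem card_div_eq_le {d : ℕ} (hd : 0 < d) (e c : ℕ) :
    #{p : Fin L | ((p : ℕ) + e) / d = c} ≤ d := by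
  conv_rhs => rw [← card_range d]
  refine card_le_card_of_injOn (fun p => ((p : ℕ) + e) % d)
    (fun p _ => by simpa using Nat.mod_lt _ hd) ?_
  intro p hp q hq hpq
  simp only [coe_filter, mem_univ, true_and, Set.mem_ofPred_eq] at hp hq hpq
  have e1 := Nat.div_add_mod ((p : ℕ) + e) d
  have e2 := Nat.div_add_mod ((q : ℕ) + e) d
  rw [hp, hpq] at e1
  rw [hq] at e2
  ext
  omega

theorem card_mod_eq_le {S R : ℕ} (hL : L = S * R) (c : ℕ) :
    #{p : Fin L | (p : ℕ) % S = c} ≤ R := by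
  conv_rhs => rw [← card_range R]
  refine card_le_card_of_injOn (fun p => (p : ℕ) / S)
    (fun p _ => by simpa using Nat.div_lt_of_lt_mul (hL ▸ p.2)) ?_
  intro p hp q hq hpq
  simp only [coe_filter, mem_univ, true_and, Set.mem_ofPred_eq] at hp hq hpq
  ext
  rw [← Nat.div_add_mod (p : ℕ) S, ← Nat.div_add_mod (q : ℕ) S, hpq, hp, hq]

/-- Columnsort, with the blocks sorted by a given network. -/
theorem SortNet.columnsort {M j R S h k : ℕ} (hN : SortNet M j R) (hS : 0 < S) (hh : 0 < h)
    (hk : 0 < k) (h1 : S * h ≤ R) (h2 : h * k ≤ R) (h3 : 2 * (k * S) ≤ R) :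
    SortNet M (4 * j) (S * h * k) := by
  have hkS : 0 < 2 * (k * S) := by positivity
  obtain ⟨b₁, l₁, M₁, s₁⟩ := hN.simulate (L := S * h * k) (f := fun p => (p : ℕ) / (S * h))
    fun c => (card_div_eq_le (Nat.mul_pos hS hh) 0 c).trans h1
  obtain ⟨b₂, l₂, M₂, s₂⟩ := hN.simulate (L := S * h * k) (f := fun p => (p : ℕ) % S)
    fun c => (card_mod_eq_le (mul_assoc S h k) c).trans h2
  obtain ⟨b₃, l₃, M₃, s₃⟩ := hN.simulate (L := S * h * k) (f := fun p => (p : ℕ) / (2 * (k * S)))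
    fun c => (card_div_eq_le hkS 0 c).trans h3
  obtain ⟨b₄, l₄, M₄, s₄⟩ := hN.simulate (L := S * h * k)
    (f := fun p => ((p : ℕ) + k * S) / (2 * (k * S)))
    fun c => (card_div_eq_le hkS _ c).trans h3
  refine ⟨b₁ ++ b₂ ++ b₃ ++ b₄, by simp only [List.length_append]; omega, ?_, fun Z => ?_⟩
  · intro b hb
    simp only [List.mem_append] at hb
    rcases hb with ((hb | hb) | hb) | hb
    exacts [M₁ b hb, M₂ b hb, M₃ b hb, M₄ b hb]
  · rw [sortSets_append, sortSets_append, sortSets_append, s₁, s₂, s₃, s₄]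
    exact isLowerSet_columnsort hS hk rfl Z

/-- All `n²` keys are sorted by `16` rounds of sorting blocks of `O(n)` keys. -/
theorem sortNet_sq {n : ℕ} (hn : 0 < n) : SortNet (8 * n) 16 (n * n) := by
  obtain ⟨u, hu, h1, h2⟩ : ∃ u, 0 < u ∧ n ≤ u * u ∧ 2 * u * u ≤ 8 * n := by
    -- As `Nat.sqrt n ≥ 1`, this `u` is at most `2 * Nat.sqrt n`, so `u * u ≤ 4 * n`.
    refine ⟨Nat.sqrt n + 1, Nat.succ_pos _, (Nat.lt_succ_sqrt n).le, ?_⟩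
    have ha := Nat.sqrt_le n
    have hb : 0 < Nat.sqrt n := Nat.sqrt_pos.mpr hn
    nlinarith
  -- Taking `h = 2 * S` makes columns (`h * k`) and double windows (`2 * k * S`) equally large: `2 *
  -- u ^ 2` here and `2 * u ^ 3` at the next level.
  have hA : SortNet (8 * n) 4 (u * (2 * u) * u) :=
    ((sortNet_one (8 * n)).mono h2).columnsort hu (by omega) hu
      (by nlinarith) (by nlinarith) (by nlinarith)
  have hB : SortNet (8 * n) 16 (u * (2 * u) * (u * u)) :=
    hA.columnsort hu (by omega) (Nat.mul_pos hu hu) (by nlinarith [Nat.mul_pos hu hu])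
      (by nlinarith) (by nlinarith)
  refine hB.mono ?_
  calc n * n ≤ (u * u) * (u * u) := Nat.mul_le_mul h1 h1
    _ ≤ u * (2 * u) * (u * u) := Nat.mul_le_mul_right _ (by nlinarith)

end SortNet

/-! ### From thresholds to keys -/

section SortArray

variable {L : ℕ} {K : Type u} [LinearOrder K] [Fintype K]

theorem exists_blockRank_lt_card (b : Fin L → ℕ) (a : Fin L → K) (p : Fin L) :
    ({θ | blockRank b p < #{q | b q = b p ∧ a q ≤ θ}} : Finset K).Nonempty := by
  obtain ⟨q₀, -, hq₀⟩ := exists_max_image univ a ⟨p, mem_univ p⟩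
  refine ⟨a q₀, ?_⟩
  simp only [mem_filter, mem_univ, true_and]
  refine (blockRank_lt_card b p).trans_le (card_le_card fun q hq => ?_)
  simp only [mem_filter, mem_univ, true_and] at hq ⊢
  exact ⟨hq, hq₀ q (mem_univ q)⟩

/-- Sort every block of `b` in place: the new key at `p` is the least `θ` such that more keys of
the block of `p` are at most `θ` than there are positions of this block before `p`. -/
def sortArray (b : Fin L → ℕ) (a : Fin L → K) (p : Fin L) : K :=
  min' {θ | blockRank b p < #{q | b q = b p ∧ a q ≤ θ}} (exists_blockRank_lt_card b a p)

theorem sortArray_le_iff (b : Fin L → ℕ) (a : Fin L → K) (p : Fin L) (θ : K) :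
    sortArray b a p ≤ θ ↔ blockRank b p < #{q | b q = b p ∧ a q ≤ θ} := by
  constructor
  · intro h
    have hmem := min'_mem _ (exists_blockRank_lt_card b a p)
    simp only [mem_filter, mem_univ, true_and] at hmem
    refine hmem.trans_le (card_le_card fun q hq => ?_)
    simp only [mem_filter, mem_univ, true_and] at hq ⊢
    exact ⟨hq.1, hq.2.trans h⟩
  · intro h
    exact min'_le _ _ (by simpa using h)

/-- Locality: this is what lets the owner of a block sort it without knowing the rest of the array.
-/
theorem sortArray_congr {b : Fin L → ℕ} {a a' : Fin L → K} {p : Fin L}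
    (h : ∀ q, b q = b p → a q = a' q) : sortArray b a p = sortArray b a' p := by
  refine eq_of_forall_ge_iff fun θ => ?_
  rw [sortArray_le_iff, sortArray_le_iff]
  have : ∀ q, (b q = b p ∧ a q ≤ θ) ↔ (b q = b p ∧ a' q ≤ θ) := fun q =>
    and_congr_right fun hq => by rw [h q hq]
  simp only [this]

/-- The successive effect of a list of block sorts. -/
def sortArrays (bs : List (Fin L → ℕ)) (a : Fin L → K) : Fin L → K :=
  bs.foldl (fun a b => sortArray b a) a

/-- The 0-1 principle: comparing with a threshold commutes with block sorting. -/
theorem filter_sortArrays_le (bs : List (Fin L → ℕ)) (a : Fin L → K) (θ : K) :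
    ({p | sortArrays bs a p ≤ θ} : Finset (Fin L)) = sortSets bs {p | a p ≤ θ} := by
  induction bs generalizing a with
  | nil => rfl
  | cons b bs ih =>
    refine (ih (sortArray b a)).trans ?_
    change _ = sortSets bs (sortSet b _)
    congr 1
    ext p
    simp [mem_sortSet, sortArray_le_iff]

/-- A network that sorts at every threshold sorts arrays. -/
theorem sortArrays_le_iff {bs : List (Fin L → ℕ)}
    (hbs : ∀ Z : Finset (Fin L), IsLowerSet (sortSets bs Z : Set (Fin L)))
    (a : Fin L → K) (p : Fin L) (θ : K) :
    sortArrays bs a p ≤ θ ↔ (p : ℕ) < #{q | a q ≤ θ} := by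
  have h1 : sortArrays bs a p ≤ θ ↔ p ∈ ({p | sortArrays bs a p ≤ θ} : Finset (Fin L)) := by simp
  rw [h1, filter_sortArrays_le, mem_iff_lt_card_of_isLowerSet (hbs _), card_sortSets]

theorem getElem_le_iff_lt_countP {K : Type u} [LinearOrder K] {l : List K} (hl : l.Pairwise (· ≤ ·)) (θ : K) {i : ℕ}
    (hi : i < l.length) : l[i] ≤ θ ↔ i < l.countP (· ≤ θ) := by
  induction l generalizing i with
  | nil => simp at hi
  | cons y l ih =>
    rw [List.pairwise_cons] at hl
    by_cases hy : y ≤ θ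
    · rw [List.countP_cons_of_pos (by simpa using hy)]
      cases i with
      | zero => simpa using hy
      | succ i =>
        simp only [List.getElem_cons_succ, Nat.add_lt_add_iff_right]
        exact ih hl.2 (by simpa using hi)
    · have h0 : (y :: l).countP (· ≤ θ) = 0 := by
        rw [List.countP_eq_zero]
        intro z hz
        rcases List.mem_cons.mp hz with rfl | hz
        · simpa using hy
        · simpa using (lt_of_not_ge hy).trans_le (hl.1 z hz)
      rw [h0]
      refine iff_of_false (fun h => hy ?_) (Nat.not_lt_zero i)
      cases i with
      | zero => simpa using h
      | succ i => exact (hl.1 _ (List.getElem_mem _)).trans h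

/-- The input keys, as one array in which those of node `i` precede those of node `i + 1`. -/
def inputArray {n : ℕ} (x : Fin n → Fin n → K) (p : Fin (n * n)) : K := x p.divNat p.modNat

/-- Sorting the array of all keys solves the sorting problem. -/
theorem isSortingOutput_sortArrays {n : ℕ} {bs : List (Fin (n * n) → ℕ)}
    (hbs : ∀ Z : Finset (Fin (n * n)), IsLowerSet (sortSets bs Z : Set (Fin (n * n))))
    (x : Fin n → Fin n → K) :
    IsSortingOutput x fun i r => sortArrays bs (inputArray x) (finProdFinEquiv (i, r)) := by
  intro i r
  have hlen : (sortedKeys x).length = n * n := by simp [sortedKeys]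
  have hp := (finProdFinEquiv (i, r)).2
  have hval : ((finProdFinEquiv (i, r) : Fin (n * n)) : ℕ) = (i : ℕ) * n + r := by
    simp [finProdFinEquiv, mul_comm, add_comm]
  rw [hval] at hp
  rw [List.getElem?_eq_getElem (by rw [hlen]; exact hp), Option.some_inj]
  -- Both keys are identified by the thresholds above them, which reduces the claim to counting the
  -- keys at most `θ`.
  refine eq_of_forall_ge_iff fun θ => ?_
  have hsorted : (sortedKeys x).Pairwise (· ≤ ·) := Multiset.pairwise_sort _ _
  rw [getElem_le_iff_lt_countP hsorted, sortArrays_le_iff hbs, hval]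
  have hcount : (sortedKeys x).countP (· ≤ θ) = #{q | inputArray x q ≤ θ} := by
    rw [← Multiset.coe_countP, sortedKeys, Multiset.sort_eq, Multiset.countP_map]
    change #{q : Fin n × Fin n | x q.1 q.2 ≤ θ} = _
    refine card_bij (fun q _ => finProdFinEquiv q) ?_ ?_ ?_
    · intro q hq
      have hq' : x q.1 q.2 ≤ θ := by simpa using hq
      simp only [mem_filter, mem_univ, true_and]
      have := finProdFinEquiv.symm_apply_apply q
      have h1 : (finProdFinEquiv q).divNat = q.1 := congrArg Prod.fst this
      have h2 : (finProdFinEquiv q).modNat = q.2 := congrArg Prod.snd this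
      rw [inputArray, h1, h2]
      exact hq'
    · exact fun _ _ _ _ h => finProdFinEquiv.injective h
    · intro p hp
      refine ⟨finProdFinEquiv.symm p, ?_, finProdFinEquiv.apply_symm_apply p⟩
      exact mem_filter.mpr ⟨mem_univ _, (mem_filter.mp hp).2⟩
  rw [hcount]

end SortArray

/-! ### Edge colouring and load balancing -/

section Assignment

/-- Edges of a bipartite multigraph of maximum degree `d` are coloured greedily with `2 * d`
colours. -/
theorem exists_edge_coloring {α β γ : Type*} [Fintype α] [DecidableEq α] [DecidableEq β]
    [DecidableEq γ] (src : α → β) (dst : α → γ) {d : ℕ} (hsrc : ∀ i, #{p | src p = i} ≤ d)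
    (hdst : ∀ j, #{p | dst p = j} ≤ d) :
    ∃ κ : α → ℕ, (∀ p, κ p < 2 * d) ∧
      ∀ p q, κ p = κ q → src p = src q ∨ dst p = dst q → p = q := by
  have key : ∀ s : Finset α, ∃ κ : α → ℕ, (∀ p ∈ s, κ p < 2 * d) ∧
      ∀ p ∈ s, ∀ q ∈ s, κ p = κ q → src p = src q ∨ dst p = dst q → p = q := by
    intro s
    induction s using Finset.induction_on with
    | empty => exact ⟨fun _ => 0, by simp, by simp⟩
    | insert a s ha ih =>
      obtain ⟨κ, hlt, hinj⟩ := ih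
      -- Excluding `a` itself leaves fewer than `d` edges at each endpoint, so fewer than `2 * d`
      -- colours are forbidden.
      have hA : #(({p | src p = src a} : Finset α).erase a) < d :=
        (card_erase_lt_of_mem (by simp)).trans_le (hsrc _)
      have hB : #(({p | dst p = dst a} : Finset α).erase a) < d :=
        (card_erase_lt_of_mem (by simp)).trans_le (hdst _)
      set N := ({p | src p = src a} : Finset α).erase a ∪
        ({p | dst p = dst a} : Finset α).erase a with hNdef
      have hN : #(N.image κ) < #(range (2 * d)) := by
        rw [card_range]
        have := card_union_le (({p | src p = src a} : Finset α).erase a)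
          (({p | dst p = dst a} : Finset α).erase a)
        rw [← hNdef] at this
        exact card_image_le.trans_lt (by omega)
      obtain ⟨e, he, heN⟩ := exists_mem_notMem_of_card_lt_card hN
      have hnb : ∀ q ∈ s, e = κ q → ¬ (src q = src a ∨ dst q = dst a) := by
        intro q hq hqe hadj
        refine heN (mem_image.mpr ⟨q, ?_, hqe.symm⟩)
        have hqa : q ≠ a := fun h => ha (h ▸ hq)
        simpa [N, hqa] using hadj
      refine ⟨Function.update κ a e, ?_, ?_⟩
      · intro p hp
        by_cases hpa : p = a
        · subst hpa; simpa using he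
        · rw [Function.update_of_ne hpa]
          exact hlt p (mem_of_mem_insert_of_ne hp hpa)
      · intro p hp q hq hpq hadj
        by_cases hpa : p = a <;> by_cases hqa : q = a
        · rw [hpa, hqa]
        · subst hpa
          rw [Function.update_self, Function.update_of_ne hqa] at hpq
          exact absurd (hadj.imp Eq.symm Eq.symm) (hnb q (mem_of_mem_insert_of_ne hq hqa) hpq)
        · subst hqa
          rw [Function.update_self, Function.update_of_ne hpa] at hpq
          exact absurd hadj (hnb p (mem_of_mem_insert_of_ne hp hpa) hpq.symm)
        · rw [Function.update_of_ne hpa, Function.update_of_ne hqa] at hpq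
          exact hinj p (mem_of_mem_insert_of_ne hp hpa) q (mem_of_mem_insert_of_ne hq hqa) hpq hadj
  obtain ⟨κ, h1, h2⟩ := key univ
  exact ⟨κ, fun p => h1 p (mem_univ p), fun p q => h2 p (mem_univ p) q (mem_univ q)⟩

/-- Blocks of at most `M` of `n * n` elements are distributed to `n` nodes with load at most
`n + M`. -/
theorem exists_owner {n M : ℕ} (hn : 0 < n) (b : Fin (n * n) → ℕ)
    (hb : ∀ c, #{p | b p = c} ≤ M) :
    ∃ own : ℕ → Fin n, ∀ i, #{p | own (b p) = i} ≤ n + M := by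
  have : Nonempty (Fin n) := ⟨⟨0, hn⟩⟩
  have key : ∀ s : Finset ℕ, ∃ own : ℕ → Fin n,
      ∀ i, #{p | b p ∈ s ∧ own (b p) = i} ≤ n + M := by
    intro s
    induction s using Finset.induction_on with
    | empty => exact ⟨fun _ => ⟨0, hn⟩, by simp⟩
    | insert c s hc ih =>
      obtain ⟨own, hown⟩ := ih
      -- Averaging: at most `n * n` elements are assigned so far, so some node has at most `n` of
      -- them and can take the next block.
      obtain ⟨i₀, -, hi₀⟩ : ∃ i ∈ (univ : Finset (Fin n)), #{p | b p ∈ s ∧ own (b p) = i} ≤ n := by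
        apply exists_le_of_sum_le (univ_nonempty)
        have h1 : ∑ i : Fin n, #{p | b p ∈ s ∧ own (b p) = i} = #{p | b p ∈ s} := by
          rw [card_eq_sum_card_fiberwise (f := fun p => own (b p)) (t := univ) (by simp)]
          refine sum_congr rfl fun i _ => ?_
          rw [filter_filter]
        rw [h1]
        refine (card_le_univ _).trans ?_
        simp
      refine ⟨Function.update own c i₀, fun i => ?_⟩
      by_cases hi : i = i₀
      · have hsub : ({p | b p ∈ insert c s ∧ Function.update own c i₀ (b p) = i} :
            Finset (Fin (n * n))) ⊆
            ({p | b p ∈ s ∧ own (b p) = i₀} : Finset (Fin (n * n))) ∪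
              ({p | b p = c} : Finset (Fin (n * n))) := by
          intro p hp
          simp only [mem_filter, mem_univ, true_and, mem_union, mem_insert] at hp ⊢
          by_cases hpc : b p = c
          · exact Or.inr hpc
          · rw [Function.update_of_ne hpc, hi] at hp
            exact Or.inl ⟨hp.1.resolve_left hpc, hp.2⟩
        exact (card_le_card hsub).trans ((card_union_le _ _).trans (add_le_add hi₀ (hb c)))
      · refine le_trans (card_le_card fun p hp => ?_) (hown i)
        simp only [mem_filter, mem_univ, true_and, mem_insert] at hp ⊢
        by_cases hpc : b p = c
        · rw [hpc, Function.update_self] at hp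
          exact absurd hp.2.symm hi
        · rw [Function.update_of_ne hpc] at hp
          exact ⟨hp.1.resolve_left hpc, hp.2⟩
  obtain ⟨own, hown⟩ := key (univ.image b)
  exact ⟨own, fun i => by simpa using hown i⟩

end Assignment

/-! ### Implementation by messages -/

section Protocol

/-- An algorithm is prolonged by one round, in which messages are computed from the previous
outputs, and the new outputs from the previous ones and the messages. -/
theorem Algorithm.exists_extend {n B : ℕ} {I O O' : Type u} (A : Algorithm n B I O) (T : ℕ)
    (snd : Fin n → O → Fin n → Msg B) (rcv : Fin n → O → (Fin n → Msg B) → O') :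
    ∃ A' : Algorithm n B I O', ∀ x i, A'.outputAfter (T + 1) x i =
      rcv i (A.outputAfter T x i) (fun j => snd j (A.outputAfter T x j) i) := by
  -- The left summand simulates `A` until round `T`; the right one stores the final result. Silent
  -- messages and outputs of unfinished states are arbitrary defaults.
  let A' : Algorithm n B I O' :=
    { State := A.State ⊕ O'
      init := fun i y => Sum.inl (A.init i y)
      send := fun t i s j => match s with
        | Sum.inl s => if t = T then snd i (A.output i s) j else A.send t i s j
        | Sum.inr _ => fun _ => false
      receive := fun t i s m => match s with
        | Sum.inl s => if t = T then Sum.inr (rcv i (A.output i s) m)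
            else Sum.inl (A.receive t i s m)
        | Sum.inr o => Sum.inr o
      output := fun i s => match s with
        | Sum.inl s => rcv i (A.output i s) fun _ _ => false
        | Sum.inr o => o }
  have hrun : ∀ x, ∀ t ≤ T, ∀ i, A'.run x t i = Sum.inl (A.run x t i) := by
    intro x t
    induction t with
    | zero => exact fun _ _ => rfl
    | succ t ih =>
      intro ht i
      have hne : t ≠ T := by omega
      simp only [Algorithm.run, ih (by omega), A', if_neg hne]
  refine ⟨A', fun x i => ?_⟩
  simp only [Algorithm.outputAfter, Algorithm.run, hrun x T le_rfl, A', if_true]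

variable {n B L : ℕ} {K : Type u}

/-- After `T` rounds of some algorithm, every node `i` knows the entries `F x p` of the array
computed from the input `x`, for all positions `p` that it owns, i.e. with `o p = i`. -/
def Holds (B : ℕ) (T : ℕ) (o : Fin L → Fin n) (F : (Fin n → Fin n → K) → Fin L → K) : Prop :=
  ∃ A : Algorithm n B (Fin n → K) (Fin L → K), ∀ x p, A.outputAfter T x (o p) p = F x p

theorem Holds.idle {T : ℕ} {o : Fin L → Fin n} {F : (Fin n → Fin n → K) → Fin L → K}
    (h : Holds B T o F) : Holds B (T + 1) o F := by
  obtain ⟨A, hA⟩ := h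
  obtain ⟨A', hA'⟩ := A.exists_extend T (fun _ _ _ _ => false) (fun _ a _ => a)
  exact ⟨A', fun x p => by rw [hA', hA]⟩

/-- Sorting blocks is a local computation if each block has a single owner. -/
theorem Holds.sortArray [LinearOrder K] [Fintype K] {T : ℕ} {own : ℕ → Fin n} {b : Fin L → ℕ}
    {F : (Fin n → Fin n → K) → Fin L → K} (h : Holds B T (fun p => own (b p)) F) :
    Holds B T (fun p => own (b p)) fun x => sortArray b (F x) := by
  obtain ⟨A, hA⟩ := h
  refine ⟨{ A with output := fun i s => CongestedClique.sortArray b (A.output i s) },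
    fun x p => ?_⟩
  have hrun : ∀ t i, Algorithm.run
      { A with output := fun i s => CongestedClique.sortArray b (A.output i s) } x t i =
        A.run x t i := by
    intro t
    induction t with
    | zero => exact fun _ => rfl
    | succ t ih => intro i; simp only [Algorithm.run, ih]
  simp only [Algorithm.outputAfter, hrun]
  -- Entries that a node does not own may be wrong in its copy of the array, but they lie in other
  -- blocks.
  refine sortArray_congr fun q hq => ?_
  rw [← hq]
  exact hA x q

/-- In one round, array entries move to new owners if they fit into the slots of the messages. -/
theorem Holds.hop [Nonempty K] {m T : ℕ} {o o' : Fin L → Fin n}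
    {F : (Fin n → Fin n → K) → Fin L → K} (enc : (Fin m → K) ↪ Msg B) (h : Holds B T o F)
    (slot : Fin L → Fin m)
    (hslot : ∀ p q, o p = o q → o' p = o' q → slot p = slot q → p = q) :
    Holds B (T + 1) o' F := by
  classical
  obtain ⟨A, hA⟩ := h
  obtain ⟨A', hA'⟩ := A.exists_extend T
    -- The maps `o`, `o'` and `slot` are fixed in advance, so sender and receiver agree on which
    -- position fills each slot. Empty slots carry an arbitrary key.
    (fun i a j => enc fun s => if hp : ∃ p, o p = i ∧ o' p = j ∧ slot p = s then a hp.choose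
      else Classical.arbitrary K)
    (fun _ _ msg p => Function.invFun enc (msg (o p)) (slot p))
  refine ⟨A', fun x p => ?_⟩
  rw [hA']
  simp only
  rw [Function.leftInverse_invFun enc.injective]
  have hp : ∃ q, o q = o p ∧ o' q = o' p ∧ slot q = slot p := ⟨p, rfl, rfl, rfl⟩
  rw [dif_pos hp]
  have hc := hp.choose_spec
  rw [hslot _ _ hc.1 hc.2.1 hc.2.2]
  exact hA x p

/-- Any redistribution in which each node sends and receives at most `d * n` entries takes two
rounds with messages of `2 * d` entries. -/
theorem Holds.route [Nonempty K] {d T : ℕ} {o o' : Fin L → Fin n}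
    {F : (Fin n → Fin n → K) → Fin L → K} (hn : 0 < n) (enc : (Fin (2 * d) → K) ↪ Msg B)
    (h : Holds B T o F) (ho : ∀ i, #{p | o p = i} ≤ d * n) (ho' : ∀ i, #{p | o' p = i} ≤ d * n) :
    Holds B (T + 2) o' F := by
  obtain ⟨κ, hκ, hinj⟩ := exists_edge_coloring o o' ho ho'
  -- A colour below `2 * d * n` encodes a relay (its residue mod `n`) and a slot (its quotient).
  -- Properness at the source rules out collisions in the first hop, properness at the target in the
  -- second.
  let relay : Fin L → Fin n := fun p => ⟨κ p % n, Nat.mod_lt _ hn⟩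
  let slot : Fin L → Fin (2 * d) := fun p =>
    ⟨κ p / n, (Nat.div_lt_iff_lt_mul hn).mpr (by rw [mul_assoc]; exact hκ p)⟩
  have hcol : ∀ p q, relay p = relay q → slot p = slot q → κ p = κ q := by
    intro p q h1 h2
    rw [← Nat.div_add_mod (κ p) n, ← Nat.div_add_mod (κ q) n,
      show κ p % n = κ q % n from congrArg Fin.val h1,
      show κ p / n = κ q / n from congrArg Fin.val h2]
  have h1 : Holds B (T + 1) relay F := h.hop enc slot fun p q h1 h2 h3 =>
    hinj p q (hcol p q h2 h3) (Or.inl h1)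
  exact h1.hop enc slot fun p q h1 h2 h3 => hinj p q (hcol p q h1 h3) (Or.inr h2)

/-- Each block sort takes two rounds. -/
theorem Holds.sortArrays [Nonempty K] [LinearOrder K] [Fintype K] (hn : 0 < n)
    (enc : (Fin (2 * 9) → K) ↪ Msg B) (bs : List (Fin (n * n) → ℕ))
    (hbs : ∀ b ∈ bs, ∀ c, #{p | b p = c} ≤ 8 * n) {T : ℕ} {o : Fin (n * n) → Fin n}
    {F : (Fin n → Fin n → K) → Fin (n * n) → K} (h : Holds B T o F)
    (ho : ∀ i, #{p | o p = i} ≤ 9 * n) :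
    ∃ o' : Fin (n * n) → Fin n, (∀ i, #{p | o' p = i} ≤ 9 * n) ∧
      Holds B (T + 2 * bs.length) o' fun x => sortArrays bs (F x) := by
  induction bs generalizing T o F with
  | nil => exact ⟨o, ho, h⟩
  | cons b bs ih =>
    obtain ⟨own, hown⟩ := exists_owner hn b (hbs b (by simp))
    have ho' : ∀ i, #{p | own (b p) = i} ≤ 9 * n := fun i => (hown i).trans (by omega)
    obtain ⟨o'', ho'', h''⟩ := ih (fun c hc => hbs c (by simp [hc]))
      (h.route hn enc ho ho').sortArray ho'
    refine ⟨o'', ho'', ?_⟩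
    have hlen : T + 2 * (b :: bs).length = T + 2 + 2 * bs.length := by
      rw [List.length_cons]; ring
    rw [hlen]
    exact h''

theorem card_divNat_eq (i : Fin n) : #{p : Fin (n * n) | p.divNat = i} ≤ n := by
  conv_rhs => rw [← card_fin n]
  refine card_le_card_of_injOn Fin.modNat (fun p _ => by simp) ?_
  intro p hp q hq hpq
  simp only [coe_filter, mem_univ, true_and, Set.mem_ofPred_eq] at hp hq
  exact finProdFinEquiv.symm.injective (Prod.ext (hp.trans hq.symm) hpq)

theorem exists_sortsIn [Nonempty K] [LinearOrder K] [Fintype K] (hn : 0 < n)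
    (enc : (Fin (2 * 9) → K) ↪ Msg B) :
    ∃ A : Algorithm n B (Fin n → K) (Fin n → K), SortsIn A 37 := by
  obtain ⟨bs, hlen, hM, hsort⟩ := sortNet_sq hn
  have h0 : Holds B 0 Fin.divNat (inputArray (K := K) (n := n)) :=
    ⟨{ State := Fin n → K
       init := fun _ y => y
       send := fun _ _ _ _ _ => false
       receive := fun _ _ s _ => s
       output := fun _ s p => s p.modNat }, fun x p => rfl⟩
  have hdiv : ∀ i : Fin n, #{p : Fin (n * n) | p.divNat = i} ≤ 9 * n := fun i =>
    (card_divNat_eq i).trans (by omega)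
  obtain ⟨o, ho, h1⟩ := h0.sortArrays hn enc bs hM hdiv
  have h2 := h1.route hn enc ho hdiv
  rw [hlen] at h2
  -- Two idle rounds raise 34 to 36; the last extension only restricts each node's array to its own
  -- `n` positions.
  obtain ⟨A, hA⟩ := h2.idle.idle
  obtain ⟨A', hA'⟩ := A.exists_extend 36 (fun _ _ _ _ => false)
    (fun i a _ r => a (finProdFinEquiv (i, r)))
  refine ⟨A', fun x => ?_⟩
  have : A'.outputAfter 37 x =
      fun i r => sortArrays bs (inputArray x) (finProdFinEquiv (i, r)) := by
    funext i r
    rw [hA']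
    refine Eq.trans ?_ (hA x _)
    have h3 : (finProdFinEquiv (i, r)).divNat = i :=
      congrArg Prod.fst (finProdFinEquiv.symm_apply_apply (i, r))
    rw [h3]
  rw [this]
  exact isSortingOutput_sortArrays hsort x

end Protocol

end CongestedClique

theorem theorem4p4 (c : ℕ) :
    ∃ C : ℕ, ∀ (n : ℕ) (K : Type*) [LinearOrder K] [Fintype K],
      Fintype.card K ≤ 2 ^ (c * CongestedClique.logSize n) →
        ∃ A : CongestedClique.Algorithm n (C * CongestedClique.logSize n) (Fin n → K) (Fin n → K),
          CongestedClique.SortsIn A 37 := by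
  -- A message packs `2 * 9` keys of `c * logSize n` bits each.
  refine ⟨c * (2 * 9), fun n K _ _ hK => ?_⟩
  by_cases h : 0 < n ∧ Nonempty K
  · obtain ⟨hn, hK'⟩ := h
    have hcard : Fintype.card (Fin (2 * 9) → K) ≤
        Fintype.card (CongestedClique.Msg (c * (2 * 9) * CongestedClique.logSize n)) := by
      simp only [CongestedClique.Msg, Fintype.card_fun, Fintype.card_fin, Fintype.card_bool]
      rw [mul_right_comm, pow_mul _ _ (2 * 9)]
      exact Nat.pow_le_pow_left hK _
    obtain ⟨enc⟩ := Function.Embedding.nonempty_of_card_le hcard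
    exact CongestedClique.exists_sortsIn hn enc
  -- Without nodes or without keys there is no pair of an input and a node to check.
  · exact ⟨{ State := Fin n → K
             init := fun _ y => y
             send := fun _ _ _ _ _ => false
             receive := fun _ _ s _ => s
             output := fun _ s => s },
      fun x i _ => absurd ⟨i.pos, ⟨x i i⟩⟩ h⟩
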